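/- Let $R$ be a commutative noetherian ring, $J\subset R$ an ideal, and $\mathcal C$ an $R$-linear noetherian abelian category (that is, $\mathcal C$ is essentially small and all its objects are noetherian). For any commutative noetherian ring $S$ and any $S$-linear abelian category $\mathcal D$, let $-\otimes_S-:\mathcal D\times \operatorname{mod}(S)\to\mathcal D$ be the usual tensor product with finitely generated $S$-modules, characterized by $\operatorname{Hom}_{\mathcal D}(M\otimes_S N,X)\cong\operatorname{Hom}_S(N,\operatorname{Hom}_{\mathcal D}(M,X))$ naturally in $X$, and let $\operatorname{Tor}^S_i(M,N)$ be its left derived functors in the argument $N\in\operatorname{mod}(S)$. The category $\mathcal D$ is called $S$-flat if for all $i>0$ and $N\in\operatorname{mod}(S)$ the functor $\operatorname{Tor}^S_i(-,N):\mathcal D\to\mathcal D$ is effaceable, i.e. for every $M\in\mathcal D$ there is an epimorphism $f:M'\to M$ in $\mathcal D$ such that $\operatorname{Tor}^S_i(f,N)=0$. For $n\ge 0$ let $\mathcal C_{R/J^n}$ be the full subcategory of $\mathcal C$ of objects annihilated by $J^n$, with its natural $R/J^n$-linear structure; $\mathcal C$ is called formally flat if $\mathcal C_{R/J^n}$ is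 $R/J^n$-flat for all $n$. Let $\mathcal C_t$ be the full subcategory of $\mathcal C$ of objects annihilated by some power of $J$, with its natural $R$-linear structure. Then $\mathcal C$ is formally flat if and only if $\mathcal C_t$ is $R$-flat. -/

import Mathlib

open CategoryTheory CategoryTheory.Limits
open scoped ZeroObject

universe w v u u'

noncomputable section

namespace LinearAbelian

/-! ### Enough projectives in `mod(R)` -/

section FGModule

variable (R : Type u) [CommRing R] [IsNoetherianRing R]

theorem fg_surjective_of_epi {X Y : FGModuleCat.{u} R} (f : X ⟶ Y) [Epi f] :
    Function.Surjective f.hom.hom := by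
  have h : Epi ((forget₂ (FGModuleCat R) (ModuleCat R)).map f) := inferInstance
  exact (ModuleCat.epi_iff_surjective _).1 h

theorem fg_projective_free (n : ℕ) : Projective (FGModuleCat.of R (Fin n → R)) where
  factors {E X} f e he := by
    obtain ⟨h, hh⟩ := Module.projective_lifting_property e.hom.hom f.hom.hom
      (fg_surjective_of_epi R e)
    exact ⟨FGModuleCat.ofHom h, FGModuleCat.hom_ext hh⟩

instance fg_enoughProjectives : EnoughProjectives (FGModuleCat.{u} R) where
  presentation N := by
    obtain ⟨n, f, hf⟩ := Module.Finite.exists_fin' R N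
    have := fg_projective_free R n
    let F : FGModuleCat.of R (Fin n → R) ⟶ N := FGModuleCat.ofHom f
    have hF : Epi F := ⟨fun g h e => by
      ext x
      obtain ⟨y, rfl⟩ := hf x
      exact congrArg (fun k => k.hom.hom y) e⟩
    exact ⟨⟨FGModuleCat.of R (Fin n → R), F⟩⟩

end FGModule

/-! ### The tensor product `M ⊗_R N` of an object `M` of an `R`-linear abelian category with a
finitely generated `R`-module `N` -/

section Tensor

variable {R : Type u} [CommRing R] [IsNoetherianRing R]
variable {C : Type u'} [Category.{v} C] [Abelian C] [Linear R C]

/-- Existence of an object `T` with `Hom_C(T, X) ≅ Hom_R(N, Hom_C(M, X))` naturally in `X`. -/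
theorem exists_tensor (M : C) (N : Type u) [AddCommGroup N] [Module R N] [Module.Finite R N] :
    ∃ (T : C) (t : N →ₗ[R] (M ⟶ T)), ∀ (X : C) (g : N →ₗ[R] (M ⟶ X)),
      ∃! f : T ⟶ X, ∀ y, t y ≫ f = g y := by
  have := Abelian.hasFiniteBiproducts (C := C)
  obtain ⟨n, p, hp⟩ := Module.Finite.exists_fin' R N
  obtain ⟨m, k, hk⟩ := Submodule.fg_iff_exists_fin_generating_family.1
    (IsNoetherian.noetherian (LinearMap.ker p))
  let P : C := ⨁ fun _ : Fin n => M
  let a : (Fin n → R) →ₗ[R] (M ⟶ P) :=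
    Fintype.linearCombination R (fun i => biproduct.ι (fun _ : Fin n => M) i)
  let φ : (⨁ fun _ : Fin m => M) ⟶ P := biproduct.desc fun j => a (k j)
  let b : (Fin n → R) →ₗ[R] (M ⟶ cokernel φ) := (Linear.rightComp R M (cokernel.π φ)).comp a
  have hb : LinearMap.ker p ≤ LinearMap.ker b := by
    rw [← hk, Submodule.span_le]
    rintro _ ⟨j, rfl⟩
    have h : biproduct.ι (fun _ : Fin m => M) j ≫ φ = a (k j) := by simp [φ]
    change a (k j) ≫ cokernel.π φ = 0
    rw [← h, Category.assoc, cokernel.condition, comp_zero]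
  let e := p.quotKerEquivOfSurjective hp
  let t : N →ₗ[R] (M ⟶ cokernel φ) := ((LinearMap.ker p).liftQ b hb).comp e.symm.toLinearMap
  have ht : ∀ z, t (p z) = a z ≫ cokernel.π φ := by
    intro z
    have h : e.symm (p z) = (LinearMap.ker p).mkQ z := by
      rw [LinearEquiv.symm_apply_eq]; rfl
    change ((LinearMap.ker p).liftQ b hb) (e.symm (p z)) = _
    rw [h]; rfl
  have ha : ∀ i, a (Pi.single i 1) = biproduct.ι (fun _ : Fin n => M) i := by
    intro i
    simp [a]
  refine ⟨cokernel φ, t, fun X g => ?_⟩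
  let q : P ⟶ X := biproduct.desc fun i => g (p (Pi.single i 1))
  have hq : ∀ z, a z ≫ q = g (p z) := by
    intro z
    have h : (Linear.rightComp R M q).comp a = g.comp p := by
      refine LinearMap.pi_ext' fun i => LinearMap.ext_ring ?_
      change a (Pi.single i 1) ≫ q = g (p (Pi.single i 1))
      rw [ha]; simp [q]
    exact LinearMap.congr_fun h z
  have hφ : φ ≫ q = 0 := by
    refine biproduct.hom_ext' _ _ fun j => ?_
    have hj : p (k j) = 0 := by
      have : k j ∈ LinearMap.ker p := hk ▸ Submodule.subset_span ⟨j, rfl⟩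
      exact this
    simp [φ, hq, hj]
  refine ⟨cokernel.desc φ q hφ, fun y => ?_, fun f hf => ?_⟩
  · obtain ⟨z, rfl⟩ := hp y
    rw [ht, Category.assoc, cokernel.π_desc, hq]
  · rw [← cancel_epi (cokernel.π φ), cokernel.π_desc]
    refine biproduct.hom_ext' _ _ fun i => ?_
    rw [← ha, ← Category.assoc, ← ht, hf, hq]

/-- The object `M ⊗_R N`. -/
def tensorObj (M : C) (N : FGModuleCat.{u} R) : C := (exists_tensor (R := R) M N).choose

/-- The universal `R`-linear map `N → Hom_C(M, M ⊗_R N)`. -/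
def tensorUnit (M : C) (N : FGModuleCat.{u} R) : N →ₗ[R] (M ⟶ tensorObj M N) :=
  (exists_tensor (R := R) M N).choose_spec.choose

/-- The morphism `M ⊗_R N ⟶ X` that corresponds to an `R`-linear map `N → Hom_C(M, X)`. -/
def tensorDesc {M : C} {N : FGModuleCat.{u} R} {X : C} (g : N →ₗ[R] (M ⟶ X)) :
    tensorObj M N ⟶ X :=
  ((exists_tensor (R := R) M N).choose_spec.choose_spec X g).choose

@[simp]
theorem tensorUnit_desc {M : C} {N : FGModuleCat.{u} R} {X : C} (g : N →ₗ[R] (M ⟶ X)) (y : N) :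
    tensorUnit M N y ≫ tensorDesc g = g y :=
  ((exists_tensor (R := R) M N).choose_spec.choose_spec X g).choose_spec.1 y

theorem tensor_hom_ext {M : C} {N : FGModuleCat.{u} R} {X : C} {f g : tensorObj M N ⟶ X}
    (h : ∀ y : N, tensorUnit M N y ≫ f = tensorUnit M N y ≫ g) : f = g :=
  ((exists_tensor (R := R) M N).choose_spec.choose_spec X
    ((Linear.rightComp R M g).comp (tensorUnit M N))).unique h fun _ => rfl

variable (R C)

/-- The bifunctor `(M, N) ↦ M ⊗_R N`, from `C × mod(R)` to `C`. -/
def tensor : C ⥤ FGModuleCat.{u} R ⥤ C where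
  obj M :=
    { obj N := tensorObj M N
      map {_ N'} g := tensorDesc ((tensorUnit M N').comp g.hom.hom)
      map_id N := tensor_hom_ext fun y => by simp
      map_comp f g := tensor_hom_ext fun y => by
        rw [tensorUnit_desc, ← Category.assoc, tensorUnit_desc]
        simp }
  map {M M'} f :=
    { app N := tensorDesc ((Linear.leftComp R (tensorObj M' N) f).comp (tensorUnit M' N))
      naturality N N' g := tensor_hom_ext fun y => by
        rw [← Category.assoc, tensorUnit_desc, ← Category.assoc, tensorUnit_desc]
        simp }
  map_id M := by
    ext N
    exact tensor_hom_ext fun y => by simp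
  map_comp f g := by
    ext N
    refine tensor_hom_ext fun y => ?_
    dsimp
    rw [← Category.assoc, tensorUnit_desc, tensorUnit_desc]
    simp

instance tensor_additive (M : C) : ((tensor R C).obj M).Additive where
  map_add {N N' f g} := tensor_hom_ext fun y => by
    change tensorUnit M N y ≫ tensorDesc _ =
      tensorUnit M N y ≫ (tensorDesc ((tensorUnit M N').comp f.hom.hom) +
        tensorDesc ((tensorUnit M N').comp g.hom.hom))
    rw [Preadditive.comp_add, tensorUnit_desc, tensorUnit_desc, tensorUnit_desc]
    exact map_add (tensorUnit M N') _ _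

/-- `Tor_i^R(M, N)`, the left derived functors of `M ⊗_R N` in the argument `N ∈ mod(R)`. -/
def tor (i : ℕ) : C ⥤ FGModuleCat.{u} R ⥤ C where
  obj M := ((tensor R C).obj M).leftDerived i
  map f := NatTrans.leftDerived ((tensor R C).map f) i
  map_id M := by rw [(tensor R C).map_id, NatTrans.leftDerived_id]
  map_comp f g := by rw [(tensor R C).map_comp, NatTrans.leftDerived_comp]

end Tensor

/-! ### Flatness -/

/-- Effaceability of a (homological) functor: every object `M` receives an epimorphism
`f : M' ⟶ M` such that `T f = 0`. -/
def IsEffaceable {C : Type u'} [Category.{v} C] {D : Type*} [Category* D] [HasZeroMorphisms D]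
    (T : C ⥤ D) : Prop :=
  ∀ M : C, ∃ (M' : C) (f : M' ⟶ M), Epi f ∧ T.map f = 0

/-- An `R`-linear abelian category `C` is `R`-flat if `Tor_i^R(-, N) : C ⥤ C` is effaceable for
all `i > 0` and all `N ∈ mod(R)`. -/
def IsFlat (R : Type u) [CommRing R] [IsNoetherianRing R]
    (C : Type u') [Category.{v} C] [Abelian C] [Linear R C] : Prop :=
  ∀ (i : ℕ), 0 < i → ∀ N : FGModuleCat.{u} R, IsEffaceable ((tor R C i).flip.obj N)

/-! ### The categories of objects killed by an ideal, or by some power of an ideal -/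

section Killed

variable {R : Type u} [CommRing R]
variable (C : Type u') [Category.{v} C] [Abelian C] [Linear R C]

/-- The objects of `C` that are annihilated by the ideal `I`. -/
def killedBy (I : Ideal R) : ObjectProperty C := fun X => ∀ r ∈ I, r • 𝟙 X = 0

/-- The objects of `C` that are annihilated by some power of the ideal `J`. -/
def killedByPower (J : Ideal R) : ObjectProperty C := fun X => ∃ n : ℕ, killedBy C (J ^ n) X

variable {C}

theorem killedBy_smul {I : Ideal R} {X Y : C} (h : killedBy C I X) {r : R} (hr : r ∈ I)
    (f : X ⟶ Y) : r • f = 0 := by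
  rw [← Category.id_comp f, ← Linear.smul_comp, h r hr, zero_comp]

instance killedBy_subobjects (I : Ideal R) : (killedBy C I).IsClosedUnderSubobjects where
  prop_of_mono {X Y} f _ h r hr := by
    rw [← cancel_mono f, zero_comp, Linear.smul_comp, Category.id_comp, ← Category.comp_id f,
      ← Linear.comp_smul, h r hr, comp_zero]

instance killedBy_quotients (I : Ideal R) : (killedBy C I).IsClosedUnderQuotients where
  prop_of_epi {X Y} f _ h r hr := by
    rw [← cancel_epi f, comp_zero, Linear.comp_smul, Category.comp_id, killedBy_smul h hr]

theorem killedBy_pi {I : Ideal R} {ι : Type*} {F : Discrete ι ⥤ C} {c : Cone F}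
    (hc : IsLimit c) (h : ∀ i, killedBy C I (F.obj i)) : killedBy C I c.pt := fun r hr =>
  hc.hom_ext fun i => by
    rw [zero_comp, Linear.smul_comp, Category.id_comp, ← Category.comp_id (c.π.app i),
      ← Linear.comp_smul, h i r hr, comp_zero]

instance killedBy_zero (I : Ideal R) : (killedBy C I).ContainsZero where
  exists_zero := ⟨0, isZero_zero C, fun _ _ => (isZero_zero C).eq_of_src _ _⟩

instance killedBy_products (I : Ideal R) : (killedBy C I).IsClosedUnderFiniteProducts := by
  refine ⟨fun J _ => ⟨?_⟩⟩
  rintro X ⟨h⟩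
  exact killedBy_pi h.isLimit h.prop_diag_obj

theorem killedBy_mono {I I' : Ideal R} (h : I ≤ I') : killedBy C I' ≤ killedBy C I :=
  fun _ hX r hr => hX r (h hr)

instance killedByPower_subobjects (J : Ideal R) :
    (killedByPower C J).IsClosedUnderSubobjects where
  prop_of_mono f _ h := h.imp fun n hn => (killedBy C (J ^ n)).prop_of_mono f hn

instance killedByPower_quotients (J : Ideal R) :
    (killedByPower C J).IsClosedUnderQuotients where
  prop_of_epi f _ h := h.imp fun n hn => (killedBy C (J ^ n)).prop_of_epi f hn

instance killedByPower_zero (J : Ideal R) : (killedByPower C J).ContainsZero where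
  exists_zero := ⟨0, isZero_zero C, 0, fun _ _ => (isZero_zero C).eq_of_src _ _⟩

instance killedByPower_products (J : Ideal R) :
    (killedByPower C J).IsClosedUnderFiniteProducts := by
  refine ⟨fun K _ => ⟨?_⟩⟩
  rintro X ⟨h⟩
  choose n hn using h.prop_diag_obj
  have := Fintype.ofFinite K
  refine ⟨∑ k : K, n ⟨k⟩, killedBy_pi h.isLimit fun i => ?_⟩
  exact killedBy_mono (Ideal.pow_le_pow_right
    (Finset.single_le_sum (f := fun k : K => n ⟨k⟩) (fun _ _ => Nat.zero_le _)
      (Finset.mem_univ i.as))) _ (hn i)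

variable (C)

/-- The category `C_{R/I}`: the full subcategory of objects annihilated by `I`. -/
abbrev QuotCat (I : Ideal R) := (killedBy C I).FullSubcategory

/-- The category `C_t`: the full subcategory of objects annihilated by some power of `J`. It is
`R`-linear as a full subcategory of `C`. -/
abbrev TorsionCat (J : Ideal R) := (killedByPower C J).FullSubcategory

variable {C}

theorem quot_isTorsionBySet (I : Ideal R) (X Y : QuotCat C I) :
    Module.IsTorsionBySet R (X ⟶ Y) I := fun f r => by
  ext
  exact killedBy_smul X.property r.2 f.hom

/-- The `R/I`-linear structure of `C_{R/I}`: the class of `r` acts on morphisms as `r` does. -/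
instance quotLinear (I : Ideal R) : Linear (R ⧸ I) (QuotCat C I) where
  homModule X Y := (quot_isTorsionBySet I X Y).module
  smul_comp X Y Z r f g := by
    obtain ⟨r, rfl⟩ := Ideal.Quotient.mk_surjective r
    exact Linear.smul_comp X Y Z r f g
  comp_smul X Y Z f r g := by
    obtain ⟨r, rfl⟩ := Ideal.Quotient.mk_surjective r
    exact Linear.comp_smul X Y Z f r g

/-- The `R`-linear category `C` is formally flat (with respect to the ideal `J`) if `C_{R/J^n}` is
`R/J^n`-flat for all `n`. -/
def IsFormallyFlat (J : Ideal R) [IsNoetherianRing R]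
    (C : Type u') [Category.{v} C] [Abelian C] [Linear R C] : Prop :=
  ∀ n : ℕ, IsFlat (R ⧸ J ^ n) (QuotCat C (J ^ n))

end Killed

end LinearAbelian

end

/-! Flatness can be tested on monomorphisms instead of on Tor (`isFlat_iff_tensorKills`): it says
that for every object `M` and every mono `ι : K ⟶ L` of finitely generated modules, some epi `f : M'
⟶ M` makes `f ⊗ K` vanish on the kernel of `M' ⊗ ι`. In this form it can be computed inside the
ambient category. If `P` is closed under subobjects, quotients and finite products and `R → S` is
surjective, both tensor products agree on `P`, so `S`-flatness of `P` concerns only `M`, `M'` in `P`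
and `R`-modules killed by the kernel of `R → S` (`isFlat_fullSubcategory_iff`).

If `C_t` is flat, let `J^n` kill `M`, `K` and `L`. An epi `M' ⟶ M` found in `C_t` factors through
`M'/J^n M'`. This passage leaves the tensor products with `K` and `L` unchanged, so `M'/J^n M' ⟶ M`
works in `C_{R/J^n}` (`TensorKills.of_reduction`).

Conversely, let `J^n` kill `M` and let `K ⊂ L` be arbitrary. Artin-Rees gives `m ≥ n` with `K ∩ J^m
L ⊂ J^n K`. Put `K' = K/(K ∩ J^m L)`, which embeds in `L/J^m L`, and choose `f : M' ⟶ M` for this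
mono by flatness of `C_{R/J^m}`. Since `J^n K` dies in `M ⊗ K`, the map `M ⊗ K ⟶ M ⊗ K'` is mono, so
the vanishing for `K'` gives that for `K` (`TensorKills.of_quotient`). -/

noncomputable section

namespace LinearAbelian

/-! ### Morphisms that vanish on kernels -/

section KernelLE

/-- The morphism `b` vanishes on the kernel of `a`. -/
def KernelLE {C : Type*} [Category* C] [HasZeroMorphisms C] {X Y Z : C} (a : X ⟶ Y) (b : X ⟶ Z) :
    Prop :=
  ∀ ⦃A : C⦄ (x : A ⟶ X), x ≫ a = 0 → x ≫ b = 0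

variable {C D : Type*} [Category* C] [Category* D] [Abelian C] [Abelian D]

/-- `KernelLE` quantifies over test objects of the ambient category, and those of `D` need not come
from `C`. As `F` preserves the kernel of `a`, every test morphism factors through the image of
`kernel.ι a`, which does come from `C`. -/
theorem kernelLE_map_iff (F : C ⥤ D) [F.PreservesZeroMorphisms]
    [F.Faithful] {X Y Z : C} (a : X ⟶ Y) (b : X ⟶ Z) [PreservesLimit (parallelPair a 0) F] :
    KernelLE (F.map a) (F.map b) ↔ KernelLE a b := by
  refine ⟨fun h A x hx => F.map_injective ?_, fun h A x hx => ?_⟩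
  · rw [F.map_comp, h, F.map_zero]
    rw [← F.map_comp, hx, F.map_zero]
  · have hk := isLimitForkMapOfIsLimit' F (kernel.condition a) (kernelIsKernel a)
    obtain ⟨l, hl⟩ := KernelFork.IsLimit.lift' hk x hx
    have hl' : l ≫ F.map (kernel.ι a) = x := hl
    rw [← hl', Category.assoc, ← F.map_comp, h _ (kernel.condition a), F.map_zero, comp_zero]

theorem homologyMap_eq_zero_iff_up_to_refinements {ι : Type*} {c : ComplexShape ι}
    {K L : HomologicalComplex C c} (φ : K ⟶ L) (i j k : ι) (hi : c.prev j = i)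
    (hk : c.next j = k) :
    HomologicalComplex.homologyMap φ j = 0 ↔ ∀ ⦃A : C⦄ (x : A ⟶ K.X j) (_ : x ≫ K.d j k = 0),
      ∃ (A' : C) (π : A' ⟶ A) (_ : Epi π) (y : A' ⟶ L.X i),
        π ≫ x ≫ φ.f j = y ≫ L.d i j := by
  have key : ∀ ⦃A : C⦄ (x : A ⟶ K.X j) (hx : x ≫ K.d j k = 0),
      (K.liftCycles x k hk hx ≫ K.homologyπ j) ≫ HomologicalComplex.homologyMap φ j = 0 ↔
        ∃ (A' : C) (π : A' ⟶ A) (_ : Epi π) (y : A' ⟶ L.X i),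
          π ≫ x ≫ φ.f j = y ≫ L.d i j := fun A x hx => by
    rw [← L.liftCycles_comp_homologyπ_eq_zero_iff_up_to_refinements i j k hi hk (x ≫ φ.f j)
      (by rw [Category.assoc, φ.comm, reassoc_of% hx, zero_comp])]
    simp
  refine ⟨fun h A x hx => (key x hx).1 (by rw [h, comp_zero]), fun h => ?_⟩
  -- It suffices to treat the universal cycle, whose class is the epimorphism `K.homologyπ j`.
  have := (key (K.iCycles j) (by simp)).2 (h _ (by simp))
  have hid : K.liftCycles (K.iCycles j) k hk (by simp) = 𝟙 _ := by
    simp [← cancel_mono (K.iCycles j)]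
  rwa [hid, Category.id_comp, ← comp_zero (X := K.cycles j) (f := K.homologyπ j),
    cancel_epi] at this

end KernelLE

/-! ### Right exactness of the tensor product -/

section RightExact

variable {R : Type u} [CommRing R] [IsNoetherianRing R]
variable {C : Type u'} [Category.{v} C] [Abelian C] [Linear R C]

variable (R) in
/-- The universal linear map `N → Hom(M, M ⊗ N)`, with target the value of the bifunctor. -/
def tensorMk (M : C) (N : FGModuleCat.{u} R) : N →ₗ[R] (M ⟶ ((tensor R C).obj M).obj N) :=
  tensorUnit M N

/-- The morphism `M ⊗ N ⟶ X` given by a linear map `N → Hom(M, X)`. -/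
def tensorLift {M : C} {N : FGModuleCat.{u} R} {X : C} (g : N →ₗ[R] (M ⟶ X)) :
    ((tensor R C).obj M).obj N ⟶ X :=
  tensorDesc g

@[simp]
theorem tensorMk_lift {M : C} {N : FGModuleCat.{u} R} {X : C} (g : N →ₗ[R] (M ⟶ X)) (y : N) :
    tensorMk R M N y ≫ tensorLift g = g y :=
  tensorUnit_desc g y

theorem tensor_ext {M : C} {N : FGModuleCat.{u} R} {X : C}
    {f g : ((tensor R C).obj M).obj N ⟶ X}
    (h : ∀ y : N, tensorMk R M N y ≫ f = tensorMk R M N y ≫ g) : f = g :=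
  tensor_hom_ext h

@[simp]
theorem tensorMk_map (M : C) {N N' : FGModuleCat.{u} R} (g : N ⟶ N') (y : N) :
    tensorMk R M N y ≫ ((tensor R C).obj M).map g = tensorMk R M N' (g.hom.hom y) :=
  tensorUnit_desc _ y

@[simp]
theorem tensorMk_map_app {M M' : C} (f : M ⟶ M') (N : FGModuleCat.{u} R) (y : N) :
    tensorMk R M N y ≫ ((tensor R C).map f).app N = f ≫ tensorMk R M' N y :=
  tensorUnit_desc _ y

theorem tensor_map_epi (M : C) {N N' : FGModuleCat.{u} R} (g : N ⟶ N')
    (hg : Function.Surjective g.hom.hom) : Epi (((tensor R C).obj M).map g) where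
  left_cancellation a b h := tensor_ext fun y => by
    obtain ⟨y, rfl⟩ := hg y
    rw [← tensorMk_map M g, Category.assoc, h, Category.assoc]

theorem fg_function_exact {S : ShortComplex (FGModuleCat.{u} R)} (hS : S.Exact) :
    Function.Exact S.f.hom.hom S.g.hom.hom := by
  have h := hS.map (forget₂ (FGModuleCat R) (ModuleCat R))
  exact (ShortComplex.ShortExact.moduleCat_exact_iff_function_exact _).1 h

/-- By the universal property, a morphism out of `M ⊗ S.X₂` that vanishes on `M ⊗ S.X₁` is a linear
map that kills the kernel of `S.g`, hence descends along the surjection `S.g`. -/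
theorem tensor_exact (M : C) {S : ShortComplex (FGModuleCat.{u} R)} (hS : S.Exact) [Epi S.g] :
    (S.map ((tensor R C).obj M)).Exact := by
  have hg := fg_surjective_of_epi R S.g
  have hfg := fg_function_exact hS
  have : Epi (S.map ((tensor R C).obj M)).g := tensor_map_epi M S.g hg
  refine ShortComplex.exact_of_g_is_cokernel _ (CokernelCofork.IsColimit.ofπ' _ _
    fun {X} (k : ((tensor R C).obj M).obj S.X₂ ⟶ X)
      (hk : ((tensor R C).obj M).map S.f ≫ k = 0) => ?_)
  let b : S.X₂ →ₗ[R] (M ⟶ X) := (Linear.rightComp R M k).comp (tensorMk R M S.X₂)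
  have hb : LinearMap.ker S.g.hom.hom ≤ LinearMap.ker b := by
    intro y hy
    obtain ⟨z, rfl⟩ := (hfg y).1 hy
    change tensorMk R M S.X₂ _ ≫ k = 0
    rw [← tensorMk_map, Category.assoc]
    rw [hk, comp_zero]
  let e := S.g.hom.hom.quotKerEquivOfSurjective hg
  refine ⟨tensorLift (((LinearMap.ker S.g.hom.hom).liftQ b hb).comp e.symm.toLinearMap),
    tensor_ext fun y => ?_⟩
  have h : e.symm (S.g.hom.hom y) = (LinearMap.ker S.g.hom.hom).mkQ y := by
    rw [LinearEquiv.symm_apply_eq]; rfl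
  change tensorMk R M S.X₂ y ≫ ((tensor R C).obj M).map S.g ≫ _ = tensorMk R M S.X₂ y ≫ k
  rw [← Category.assoc, tensorMk_map, tensorMk_lift]
  change (LinearMap.ker S.g.hom.hom).liftQ b hb (e.symm (S.g.hom.hom y)) = _
  rw [h]
  rfl

end RightExact

/-! ### Flatness in terms of monomorphisms of modules -/

section FlatIff

variable {R : Type u} [CommRing R] [IsNoetherianRing R]
variable {C : Type u'} [Category.{v} C] [Abelian C] [Linear R C]

variable (R) in
/-- The morphism `f ⊗ K` vanishes on the kernel of `M' ⊗ ι`. -/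
def TensorKills {M' M : C} (f : M' ⟶ M) {K L : FGModuleCat.{u} R} (ι : K ⟶ L) : Prop :=
  KernelLE (((tensor R C).obj M').map ι) (((tensor R C).map f).app K)

theorem tor_map_app_eq_zero_iff {M' M : C} (f : M' ⟶ M) {N : FGModuleCat.{u} R}
    (P : ProjectiveResolution N) (n : ℕ) :
    ((tor R C (n + 1)).flip.obj N).map f = 0 ↔
      ∀ ⦃A : C⦄ (x : A ⟶ ((tensor R C).obj M').obj (P.complex.X (n + 1)))
        (_ : x ≫ ((tensor R C).obj M').map (P.complex.d (n + 1) n) = 0),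
        ∃ (A' : C) (π : A' ⟶ A) (_ : Epi π)
          (y : A' ⟶ ((tensor R C).obj M).obj (P.complex.X (n + 2))),
          π ≫ x ≫ ((tensor R C).map f).app (P.complex.X (n + 1)) =
            y ≫ ((tensor R C).obj M).map (P.complex.d (n + 2) (n + 1)) := by
  change (NatTrans.leftDerived ((tensor R C).map f) (n + 1)).app N = 0 ↔ _
  rw [ProjectiveResolution.leftDerived_app_eq _ P, Preadditive.IsIso.comp_left_eq_zero,
    Preadditive.IsIso.comp_right_eq_zero]
  exact homologyMap_eq_zero_iff_up_to_refinements _ (n + 2) (n + 1) n (by simp) (by simp)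

/-- The image `I` of `P_{n+1} ⟶ P_n` is the cokernel of `P_{n+2} ⟶ P_{n+1}`. A cycle of `M' ⊗
P_{n+1}` lands in the kernel of `M' ⊗ I ⟶ M' ⊗ P_n`, which `f` kills. Its image under `f` therefore
vanishes in `M ⊗ I`, and by right exactness it is a boundary. -/
theorem tor_map_eq_zero_of_tensorKills {M' M : C} (f : M' ⟶ M) {N : FGModuleCat.{u} R}
    (P : ProjectiveResolution N) (n : ℕ)
    (h : TensorKills R f (Abelian.image.ι (P.complex.d (n + 1) n))) :
    ((tor R C (n + 1)).flip.obj N).map f = 0 := by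
  rw [tor_map_app_eq_zero_iff f P]
  intro A x hx
  let d := P.complex.d (n + 1) n
  let e := Abelian.factorThruImage d
  have hde : P.complex.d (n + 2) (n + 1) ≫ e = 0 := by
    rw [← cancel_mono (Abelian.image.ι d), Category.assoc, Abelian.image.fac, zero_comp]
    exact P.complex.d_comp_d _ _ _
  have hex : (ShortComplex.mk _ _ hde).Exact := by
    rw [ShortComplex.exact_iff_exact_up_to_refinements]
    intro B b hb
    refine (P.exact_succ n).exact_up_to_refinements b ?_
    change b ≫ d = 0
    have hb : b ≫ e = 0 := hb
    calc b ≫ d = (b ≫ e) ≫ Abelian.image.ι d := by rw [Category.assoc, Abelian.image.fac]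
      _ = 0 := by rw [hb, zero_comp]
  have : Epi (ShortComplex.mk _ _ hde).g := inferInstanceAs (Epi e)
  refine (tensor_exact M hex).exact_up_to_refinements
    (x ≫ ((tensor R C).map f).app (P.complex.X (n + 1))) ?_
  change (x ≫ ((tensor R C).map f).app (P.complex.X (n + 1))) ≫ ((tensor R C).obj M).map e = 0
  rw [Category.assoc, ← NatTrans.naturality, ← Category.assoc]
  refine h _ ?_
  rw [Category.assoc, ← Functor.map_comp, Abelian.image.fac, hx]

/-- This replaces the connecting map `Tor₁(M', L/K) ⟶ M' ⊗ K` by a direct chase. Lifting `P₀ ⟶ L/K`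
to `L` gives an exact sequence `P₁ ⟶ K ⊞ P₀ ⟶ L ⟶ 0`. An element `x` of the kernel of `M' ⊗ ι`,
viewed as `(x, 0)`, comes from a cycle `z` of `M' ⊗ P₁`. The image of `z` under `f` is a boundary,
and boundaries die in `M ⊗ K`. -/
theorem tensorKills_of_tor_map_eq_zero {M' M : C} (f : M' ⟶ M) {K L : FGModuleCat.{u} R}
    (ι : K ⟶ L) [Mono ι] (h : ((tor R C 1).flip.obj (cokernel ι)).map f = 0) :
    TensorKills R f ι := by
  intro A x hx
  let P := projectiveResolution (cokernel ι)
  have h := (tor_map_app_eq_zero_iff f P 0).1 h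
  let d := P.complex.d 1 0
  let p : P.complex.X 0 ⟶ cokernel ι := P.π.f 0
  have hdp : d ≫ p = 0 := P.complex_d_comp_π_f_zero
  let φ : P.complex.X 0 ⟶ L := Projective.factorThru p (cokernel.π ι)
  have hφ : φ ≫ cokernel.π ι = p := Projective.factorThru_comp _ _
  have hι : (ShortComplex.mk ι _ (cokernel.condition ι)).Exact :=
    ShortComplex.exact_of_g_is_cokernel _ (cokernelIsCokernel ι)
  have : Mono (ShortComplex.mk ι _ (cokernel.condition ι)).f := inferInstanceAs (Mono ι)
  obtain ⟨ψ, hψ⟩ : ∃ ψ : P.complex.X 1 ⟶ K, ψ ≫ ι = d ≫ φ :=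
    ⟨hι.lift (d ≫ φ) (by simp [hφ, hdp]), hι.lift_f _ _⟩
  let s : P.complex.X 1 ⟶ K ⊞ P.complex.X 0 := biprod.lift (-ψ) d
  let t : K ⊞ P.complex.X 0 ⟶ L := biprod.desc ι φ
  have hst : s ≫ t = 0 := by simp [s, t, hψ]
  have ht : Epi t := by
    refine Preadditive.epi_of_cancel_zero _ fun {T} a ha => ?_
    have h1 : ι ≫ a = 0 := by simpa [t] using biprod.inl ≫= ha
    have h2 : φ ≫ a = 0 := by simpa [t] using biprod.inr ≫= ha
    have h3 : p ≫ cokernel.desc ι a h1 = 0 := by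
      rw [← hφ, Category.assoc, cokernel.π_desc, h2]
    have h4 : cokernel.desc ι a h1 = 0 := by
      have : Epi p := inferInstanceAs (Epi (P.π.f 0))
      rwa [← cancel_epi p, comp_zero]
    rw [← cokernel.π_desc ι a h1, h4, comp_zero]
  -- A pair in the kernel of `t` has its `P₀`-component in the kernel of `p`, so that component
  -- lifts to `P₁`; the `K`-components then agree because `ι` is mono.
  have hex : (ShortComplex.mk s t hst).Exact := by
    rw [ShortComplex.exact_iff_exact_up_to_refinements]
    intro B b hb
    have hb' : (b ≫ biprod.fst) ≫ ι + (b ≫ biprod.snd) ≫ φ = 0 := by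
      rw [← hb]; simp [t, biprod.desc_eq]
    have hb'' : (b ≫ biprod.snd) ≫ p = 0 := by
      have := hb' =≫ cokernel.π ι
      simpa [hφ] using this
    obtain ⟨B', π, hπ, z, hz⟩ := P.exact₀.exact_up_to_refinements (b ≫ biprod.snd) hb''
    have hz : π ≫ b ≫ biprod.snd = z ≫ d := hz
    refine ⟨B', π, hπ, z, biprod.hom_ext _ _ ?_ ?_⟩
    · rw [← cancel_mono ι]
      have := π ≫= hb'
      simp only [Category.assoc, Preadditive.comp_add, comp_zero] at this
      simp only [Category.assoc, s, biprod.lift_fst, Preadditive.comp_neg, Preadditive.neg_comp, hψ]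
      rw [eq_neg_iff_add_eq_zero, ← this]
      congr 1
      simpa using hz.symm =≫ φ
    · simpa [s] using hz
  have : Epi (ShortComplex.mk s t hst).g := ht
  obtain ⟨A₁, π₁, hπ₁, z, hz⟩ := (tensor_exact M' hex).exact_up_to_refinements
    (x ≫ ((tensor R C).obj M').map (biprod.inl : K ⟶ K ⊞ P.complex.X 0)) (by
      change (x ≫ ((tensor R C).obj M').map _) ≫ ((tensor R C).obj M').map t = 0
      rw [Category.assoc, ← Functor.map_comp]
      simpa [t] using hx)
  change A₁ ⟶ ((tensor R C).obj M').obj (P.complex.X 1) at z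
  change π₁ ≫ x ≫ ((tensor R C).obj M').map (biprod.inl : K ⟶ K ⊞ P.complex.X 0) =
    z ≫ ((tensor R C).obj M').map s at hz
  -- `z` is a cycle because `(x, 0)` has no component in `M' ⊗ P₀`.
  have hzd : z ≫ ((tensor R C).obj M').map d = 0 := by
    have hd : s ≫ biprod.snd = d := by simp [s]
    rw [← hd, Functor.map_comp, ← Category.assoc, ← hz, Category.assoc, Category.assoc,
      ← Functor.map_comp, biprod.inl_snd, Functor.map_zero, comp_zero, comp_zero]
  obtain ⟨A₂, π₂, hπ₂, y, hy⟩ := h z hzd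
  rw [← cancel_epi π₁, ← cancel_epi π₂, comp_zero, comp_zero]
  have hds : P.complex.d 2 1 ≫ s ≫ biprod.fst = 0 := by
    have hd2 : P.complex.d 2 1 ≫ d = 0 := P.complex.d_comp_d _ _ _
    rw [← cancel_mono ι]
    simp [s, hψ, reassoc_of% hd2]
  have hfK : ((tensor R C).map f).app K = ((tensor R C).obj M').map
      (biprod.inl : K ⟶ K ⊞ P.complex.X 0) ≫ ((tensor R C).map f).app (K ⊞ P.complex.X 0) ≫
        ((tensor R C).obj M).map biprod.fst := by
    rw [← Category.assoc, NatTrans.naturality, Category.assoc, ← Functor.map_comp,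
      biprod.inl_fst, CategoryTheory.Functor.map_id, Category.comp_id]
  calc π₂ ≫ π₁ ≫ x ≫ ((tensor R C).map f).app K
      = π₂ ≫ (π₁ ≫ x ≫ ((tensor R C).obj M').map (biprod.inl : K ⟶ K ⊞ P.complex.X 0)) ≫
          ((tensor R C).map f).app (K ⊞ P.complex.X 0) ≫
            ((tensor R C).obj M).map biprod.fst := by rw [hfK]; simp only [Category.assoc]
    _ = (π₂ ≫ z ≫ ((tensor R C).map f).app (P.complex.X 1)) ≫ ((tensor R C).obj M).map s ≫
          ((tensor R C).obj M).map biprod.fst := by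
        rw [hz]; simp only [Category.assoc, NatTrans.naturality_assoc]
    _ = (y ≫ ((tensor R C).obj M).map (P.complex.d 2 1)) ≫ ((tensor R C).obj M).map s ≫
          ((tensor R C).obj M).map biprod.fst := congrArg (· ≫ _) hy
    _ = 0 := by
        rw [Category.assoc, ← Functor.map_comp, ← Functor.map_comp, hds, Functor.map_zero,
          comp_zero]

variable (R C) in
/-- A category is flat if and only if every monomorphism of finitely generated modules stays
injective after tensoring, up to epimorphisms of objects. -/
theorem isFlat_iff_tensorKills :
    IsFlat R C ↔ ∀ (M : C) ⦃K L : FGModuleCat.{u} R⦄ (ι : K ⟶ L) [Mono ι],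
      ∃ (M' : C) (f : M' ⟶ M), Epi f ∧ TensorKills R f ι := by
  refine ⟨fun h M K L ι _ => ?_, fun h i hi N M => ?_⟩
  · obtain ⟨M', f, hf, h⟩ := h 1 one_pos (cokernel ι) M
    exact ⟨M', f, hf, tensorKills_of_tor_map_eq_zero f ι h⟩
  · obtain ⟨n, rfl⟩ := Nat.exists_eq_succ_of_ne_zero hi.ne'
    obtain ⟨M', f, hf, h⟩ := h M (Abelian.image.ι ((projectiveResolution N).complex.d (n + 1) n))
    exact ⟨M', f, hf, tor_map_eq_zero_of_tensorKills f _ n h⟩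

end FlatIff

/-! ### The tensor product in a full subcategory -/

section FullSubcategory

variable {R : Type u} [CommRing R] {S : Type u} [CommRing S] [Algebra R S]

variable (R S) in
/-- A finitely generated `R`-module killed by the kernel of `R → S` is the restriction of a
finitely generated `S`-module. -/
theorem exists_extend_scalars (hS : Function.Surjective (algebraMap R S)) (K : FGModuleCat.{u} R)
    (hK : ∀ r : R, algebraMap R S r = 0 → ∀ y : K, r • y = 0) :
    ∃ (K' : FGModuleCat.{u} S) (e : K ≃+ K'), ∀ (r : R) (y : K),
      e (r • y) = algebraMap R S r • e y := by
  -- A scalar of `S` acts through a chosen lift to `R`; by `hK` the choice does not matter.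
  let _ : SMul S K := ⟨fun s y => Function.surjInv hS s • y⟩
  have hsmul : ∀ (r : R) (y : K), algebraMap R S r • y = r • y := fun r y => by
    refine sub_eq_zero.1 ((sub_smul _ _ y).symm.trans (hK _ ?_ y))
    rw [map_sub, Function.surjInv_eq hS, sub_self]
  let _ : Module S K := Function.Surjective.moduleLeft (algebraMap R S) hS hsmul
  have : IsScalarTower R S K := IsScalarTower.of_algebraMap_smul hsmul
  have : Module.Finite S K := Module.Finite.of_restrictScalars_finite R S K
  exact ⟨FGModuleCat.of S K, AddEquiv.refl _, fun r y => (hsmul r y).symm⟩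

variable (R S) in
theorem exists_restrict_scalars (hS : Function.Surjective (algebraMap R S))
    (K : FGModuleCat.{u} S) :
    ∃ (K₀ : FGModuleCat.{u} R) (e : K₀ ≃+ K), ∀ (r : R) (y : K₀),
      e (r • y) = algebraMap R S r • e y := by
  let _ : Module R K := Module.compHom K (algebraMap R S)
  have : IsScalarTower R S K := IsScalarTower.of_algebraMap_smul fun _ _ => rfl
  have : Module.Finite R S := Module.Finite.of_surjective (Algebra.linearMap R S) hS
  have : Module.Finite R K := Module.Finite.trans S K
  exact ⟨FGModuleCat.of R K, AddEquiv.refl _, fun r y => rfl⟩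

theorem fg_mono_of_injective {X Y : FGModuleCat.{u} R} (f : X ⟶ Y)
    (hf : Function.Injective f.hom.hom) : Mono f where
  right_cancellation g h H := by
    ext x
    exact hf (congrArg (fun k => k.hom.hom x) H)

variable {C : Type u'} [Category.{v} C] [Abelian C] [Linear R C]

theorem algebraMap_smul_hom {P : ObjectProperty C}
    [Linear S P.FullSubcategory] [∀ X Y : P.FullSubcategory, IsScalarTower R S (X ⟶ Y)]
    {X Y : P.FullSubcategory} (r : R) (f : X ⟶ Y) :
    (algebraMap R S r • f).hom = r • f.hom := by
  rw [algebraMap_smul]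
  rfl

variable [IsNoetherianRing R] [IsNoetherianRing S]

theorem fg_injective_of_mono {X Y : FGModuleCat.{u} R} (f : X ⟶ Y) [Mono f] :
    Function.Injective f.hom.hom := by
  have h : Mono ((forget₂ (FGModuleCat R) (ModuleCat R)).map f) := inferInstance
  exact (ModuleCat.mono_iff_injective _).1 h
-- If `N` has `n` generators, `M ⊗ N` is a quotient of `M^n`.
theorem prop_tensor (P : ObjectProperty C) [P.IsClosedUnderQuotients]
    [P.IsClosedUnderFiniteProducts] {M : C} (hM : P M) (N : FGModuleCat.{u} R) :
    P (((tensor R C).obj M).obj N) := by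
  have := Abelian.hasFiniteBiproducts (C := C)
  obtain ⟨n, p, hp⟩ := Module.Finite.exists_fin' R N
  let q : (⨁ fun _ : Fin n => M) ⟶ ((tensor R C).obj M).obj N :=
    biproduct.desc fun i => tensorMk R M N (p (Pi.single i 1))
  have hq : Epi q := by
    refine Preadditive.epi_of_cancel_zero _ fun {T} a ha => tensor_ext fun y => ?_
    obtain ⟨z, rfl⟩ := hp y
    have h : (Linear.rightComp R M a).comp ((tensorMk R M N).comp p) = 0 := by
      refine LinearMap.pi_ext' fun i => LinearMap.ext_ring ?_
      have := biproduct.ι (fun _ : Fin n => M) i ≫= ha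
      simpa [q] using this
    rw [comp_zero]
    exact LinearMap.congr_fun h z
  have hb : P (⨁ fun _ : Fin n => M) :=
    P.prop_of_isLimit (biproduct.isLimit fun _ : Fin n => M) fun _ => hM
  exact P.prop_of_epi q hb

variable {P : ObjectProperty C} [P.IsClosedUnderSubobjects] [P.IsClosedUnderQuotients]
  [P.ContainsZero] [P.IsClosedUnderFiniteProducts]
variable [Linear S P.FullSubcategory] [∀ X Y : P.FullSubcategory, IsScalarTower R S (X ⟶ Y)]
variable (M : P.FullSubcategory) {N₀ : FGModuleCat.{u} R} {N : FGModuleCat.{u} S}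
  (e : N₀ ≃+ N) (he : ∀ (r : R) (y : N₀), e (r • y) = algebraMap R S r • e y)

/-- The comparison of the tensor product in `C` with the one in a full subcategory. -/
def tensorCompare :
    ((tensor R C).obj M.obj).obj N₀ ⟶ (((tensor S P.FullSubcategory).obj M).obj N).obj :=
  tensorLift
    { toFun y := (tensorMk S M N (e y)).hom
      map_add' y z := by rw [map_add, map_add]; rfl
      map_smul' r y := by rw [he, map_smul, algebraMap_smul_hom]; rfl }

@[simp]
theorem tensorMk_compare (y : N₀) :
    tensorMk R M.obj N₀ y ≫ tensorCompare M e he = (tensorMk S M N (e y)).hom :=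
  tensorMk_lift _ y

/-- The tensor product formed in `C` already lies in `P` by `prop_tensor`, so the universal property
inside the subcategory applies to it. Surjectivity of `R → S` turns its `R`-linear universal map
into an `S`-linear one. -/
theorem isIso_tensorCompare (hS : Function.Surjective (algebraMap R S)) :
    IsIso (tensorCompare M e he) := by
  let T : P.FullSubcategory := ⟨_, prop_tensor P M.property N₀⟩
  let k : N →ₗ[S] (M ⟶ T) :=
    { toFun y := P.homMk (tensorMk R M.obj N₀ (e.symm y))
      map_add' y z := by ext; simp; rfl
      map_smul' s y := by
        obtain ⟨r, rfl⟩ := hS s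
        ext
        rw [RingHom.id_apply, algebraMap_smul_hom]
        change tensorMk R M.obj N₀ (e.symm _) = r • tensorMk R M.obj N₀ (e.symm y)
        rw [← map_smul]
        congr 1
        rw [AddEquiv.symm_apply_eq, he, AddEquiv.apply_symm_apply] }
  have hk : ∀ y, (tensorMk S M N y).hom ≫ (tensorLift k).hom = tensorMk R M.obj N₀ (e.symm y) :=
    fun y => congrArg (fun f => f.hom) (tensorMk_lift k y)
  refine ⟨(tensorLift k).hom, tensor_ext fun y => ?_, ?_⟩
  · rw [← Category.assoc, tensorMk_compare, hk, e.symm_apply_apply, Category.comp_id]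
  · have h : tensorLift k ≫ (P.homMk (tensorCompare M e he) :
        T ⟶ ((tensor S P.FullSubcategory).obj M).obj N) = 𝟙 _ := by
      refine tensor_ext fun y => ?_
      rw [← Category.assoc, tensorMk_lift, Category.comp_id]
      ext
      exact (tensorMk_compare M e he _).trans (by rw [e.apply_symm_apply])
    exact congrArg (fun f => f.hom) h

theorem tensorCompare_map {K₀ : FGModuleCat.{u} R} {K : FGModuleCat.{u} S} (e' : K₀ ≃+ K)
    (he' : ∀ (r : R) (y : K₀), e' (r • y) = algebraMap R S r • e' y) (g₀ : N₀ ⟶ K₀) (g : N ⟶ K)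
    (h : ∀ y, e' (g₀.hom.hom y) = g.hom.hom (e y)) :
    tensorCompare M e he ≫ (((tensor S P.FullSubcategory).obj M).map g).hom =
      ((tensor R C).obj M.obj).map g₀ ≫ tensorCompare M e' he' := by
  refine tensor_ext fun y => ?_
  rw [← Category.assoc, tensorMk_compare, ← Category.assoc, tensorMk_map, tensorMk_compare, h]
  exact congrArg (fun f => f.hom) (tensorMk_map M g (e y))

theorem tensorCompare_map_app {M M' : P.FullSubcategory} (f : M' ⟶ M) :
    tensorCompare M' e he ≫ (((tensor S P.FullSubcategory).map f).app N).hom =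
      ((tensor R C).map f.hom).app N₀ ≫ tensorCompare M e he := by
  refine tensor_ext fun y => ?_
  rw [← Category.assoc, tensorMk_compare, ← Category.assoc, tensorMk_map_app, Category.assoc,
    tensorMk_compare]
  exact congrArg (fun f => f.hom) (tensorMk_map_app f N (e y))

theorem tensorKills_fullSubcategory_iff {N₀ : FGModuleCat.{u} R} {N : FGModuleCat.{u} S}
    (e : N₀ ≃+ N) (he : ∀ (r : R) (y : N₀), e (r • y) = algebraMap R S r • e y)
    (hS : Function.Surjective (algebraMap R S))
    {M M' : P.FullSubcategory} (f : M' ⟶ M) {K₀ : FGModuleCat.{u} R} {K : FGModuleCat.{u} S}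
    (e' : K₀ ≃+ K)
    (he' : ∀ (r : R) (y : K₀), e' (r • y) = algebraMap R S r • e' y) (g₀ : N₀ ⟶ K₀) (g : N ⟶ K)
    (h : ∀ y, e' (g₀.hom.hom y) = g.hom.hom (e y)) :
    TensorKills S f g ↔ TensorKills R f.hom g₀ := by
  have := P.preservesKernels_ι
  have := isIso_tensorCompare M' e he hS
  have := isIso_tensorCompare M e he hS
  have := isIso_tensorCompare M' e' he' hS
  have h₁ := tensorCompare_map M' e he e' he' g₀ g h
  have h₂ := tensorCompare_map_app e he f
  unfold TensorKills
  rw [← kernelLE_map_iff P.ι]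
  refine ⟨fun H A x hx => ?_, fun H A x hx => ?_⟩
  · have := H (x ≫ tensorCompare M' e he) ?_
    · rw [← cancel_mono (tensorCompare M e he), zero_comp, Category.assoc, ← h₂,
        ← Category.assoc]
      exact this
    · rw [Category.assoc]
      refine (congrArg (x ≫ ·) h₁).trans ?_
      rw [← Category.assoc, hx, zero_comp]
  · have := H (x ≫ inv (tensorCompare M' e he)) ?_
    · have h3 : ((tensor R C).map f.hom).app N₀ =
        tensorCompare M' e he ≫ (((tensor S P.FullSubcategory).map f).app N).hom ≫
          inv (tensorCompare M e he) := by
        rw [← Category.assoc, h₂, Category.assoc, IsIso.hom_inv_id, Category.comp_id]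
      rw [h3, Category.assoc, IsIso.inv_hom_id_assoc, ← Category.assoc,
        Preadditive.IsIso.comp_right_eq_zero] at this
      exact this
    · rw [← cancel_mono (tensorCompare M' e' he'), zero_comp, Category.assoc, Category.assoc,
        ← h₁, IsIso.inv_hom_id_assoc]
      exact hx

/-- Flatness of a full subcategory of `C`, in terms of the tensor product in `C`. -/
theorem isFlat_fullSubcategory_iff (hS : Function.Surjective (algebraMap R S)) :
    IsFlat S P.FullSubcategory ↔ ∀ M : C, P M → ∀ ⦃K L : FGModuleCat.{u} R⦄ (ι : K ⟶ L)
      [Mono ι], (∀ r : R, algebraMap R S r = 0 → ∀ y : L, r • y = 0) →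
        ∃ (M' : C) (_ : P M') (f : M' ⟶ M), Epi f ∧ TensorKills R f ι := by
  have := P.preservesEpimorphisms_ι_of_isNormalMonoCategory
  rw [isFlat_iff_tensorKills]
  refine ⟨fun h M hM K L ι _ hL => ?_, fun h M K L ι _ => ?_⟩
  · have hι := fg_injective_of_mono ι
    obtain ⟨L', eL, heL⟩ := exists_extend_scalars R S hS L hL
    obtain ⟨K', eK, heK⟩ := exists_extend_scalars R S hS K fun r hr y => hι (by
      rw [map_smul, hL r hr, map_zero])
    let ι' : K' ⟶ L' := FGModuleCat.ofHom
      { toFun y := eL (ι.hom.hom (eK.symm y))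
        map_add' y z := by simp only [map_add]
        map_smul' s y := by
          obtain ⟨r, rfl⟩ := hS s
          obtain ⟨y, rfl⟩ := eK.surjective y
          rw [← heK, eK.symm_apply_apply, eK.symm_apply_apply, map_smul, heL]
          rfl }
    have : Mono ι' := fg_mono_of_injective _ (eL.injective.comp (hι.comp eK.symm.injective))
    obtain ⟨M', f, hf, H⟩ := h ⟨M, hM⟩ ι'
    refine ⟨M'.obj, M'.property, f.hom, inferInstanceAs (Epi (P.ι.map f)), ?_⟩
    refine (tensorKills_fullSubcategory_iff eK heK hS f eL heL ι ι' fun y => ?_).1 H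
    change _ = eL (ι.hom.hom (eK.symm (eK y)))
    rw [eK.symm_apply_apply]
  · have hι := fg_injective_of_mono ι
    obtain ⟨L₀, eL, heL⟩ := exists_restrict_scalars R S hS L
    obtain ⟨K₀, eK, heK⟩ := exists_restrict_scalars R S hS K
    let ι₀ : K₀ ⟶ L₀ := FGModuleCat.ofHom
      { toFun y := eL.symm (ι.hom.hom (eK y))
        map_add' y z := by simp only [map_add]
        map_smul' r y := by
          rw [heK, map_smul, AddEquiv.symm_apply_eq, RingHom.id_apply, heL,
            AddEquiv.apply_symm_apply] }
    have : Mono ι₀ := fg_mono_of_injective _ (eL.symm.injective.comp (hι.comp eK.injective))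
    obtain ⟨M', hM', f, hf, H⟩ := h M.obj M.property ι₀ fun r hr y => eL.injective (by
      rw [heL, hr, zero_smul, map_zero])
    let f' : (⟨M', hM'⟩ : P.FullSubcategory) ⟶ M := P.homMk f
    have : Epi (P.ι.map f') := hf
    refine ⟨⟨M', hM'⟩, f', P.ι.epi_of_epi_map this, ?_⟩
    refine (tensorKills_fullSubcategory_iff eK heK hS f' eL heL ι₀ ι fun y => ?_).2 H
    exact eL.apply_symm_apply _

end FullSubcategory

/-! ### Reduction modulo an ideal -/

section Reduction

variable {R : Type u} [CommRing R] {C : Type u'} [Category.{v} C] [Abelian C] [Linear R C]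

theorem smul_eq_zero_of_killedBy {I : Ideal R} {X Y : C} (hY : killedBy C I Y) {r : R} (hr : r ∈ I)
    (f : X ⟶ Y) : r • f = 0 := by
  rw [← Category.comp_id f, ← Linear.comp_smul, hY r hr, comp_zero]

variable [IsNoetherianRing R]

theorem killedBy_tensor_right (I : Ideal R) (M : C) {N : FGModuleCat.{u} R}
    (hN : ∀ r ∈ I, ∀ y : N, r • y = 0) : killedBy C I (((tensor R C).obj M).obj N) :=
  fun r hr => tensor_ext fun y => by
    rw [Linear.comp_smul, Category.comp_id, ← map_smul, hN r hr, map_zero, comp_zero]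

/-- The largest quotient `M / I M` of `M` killed by `I`. -/
theorem exists_reduction (I : Ideal R) (M : C) :
    ∃ (Q : C) (q : M ⟶ Q), killedBy C I Q ∧ Epi q ∧
      ∀ ⦃X : C⦄ (_ : killedBy C I X) (g : M ⟶ X), ∃ g' : Q ⟶ X, q ≫ g' = g := by
  -- The quotient `M / I M` is realized as `M ⊗ R/I`, with projection given by the class of `1`.
  let A := FGModuleCat.of R (R ⧸ I)
  let a : A := (Submodule.Quotient.mk 1 : R ⧸ I)
  have ha : ∀ y : A, ∃ r : R, y = r • a := fun y => by
    obtain ⟨r, rfl⟩ := Submodule.Quotient.mk_surjective I y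
    exact ⟨r, by rw [← Submodule.Quotient.mk_smul, smul_eq_mul, mul_one]⟩
  refine ⟨((tensor R C).obj M).obj A, tensorMk R M A a, killedBy_tensor_right I M ?_, ?_, ?_⟩
  · intro r hr y
    obtain ⟨s, rfl⟩ := Submodule.Quotient.mk_surjective I y
    rw [← Submodule.Quotient.mk_smul]
    exact (Submodule.Quotient.mk_eq_zero I).2 (I.mul_mem_right s hr)
  · refine ⟨fun g h H => tensor_ext fun y => ?_⟩
    obtain ⟨r, rfl⟩ := ha y
    rw [map_smul, Linear.smul_comp, Linear.smul_comp, H]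
  · intro X hX g
    let l : (R ⧸ I) →ₗ[R] (M ⟶ X) := Submodule.liftQ I (LinearMap.toSpanSingleton R _ g)
      fun r hr => smul_eq_zero_of_killedBy hX hr g
    refine ⟨tensorLift (N := A) l, (tensorMk_lift (N := A) l a).trans ?_⟩
    exact (Submodule.liftQ_apply _ _ _).trans (one_smul R g)

/-- As `M ⊗ N` is killed by `I`, the universal maps `M ⟶ M ⊗ N` factor through `Q`, which provides
the inverse. -/
theorem isIso_tensor_map_app_of_reduction {I : Ideal R} {M Q : C} (q : M ⟶ Q) [Epi q]
    (hq : ∀ ⦃X : C⦄ (_ : killedBy C I X) (g : M ⟶ X), ∃ g' : Q ⟶ X, q ≫ g' = g)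
    {N : FGModuleCat.{u} R} (hN : ∀ r ∈ I, ∀ y : N, r • y = 0) :
    IsIso (((tensor R C).map q).app N) := by
  choose k hk using fun y : N => hq (killedBy_tensor_right I M hN) (tensorMk R M N y)
  let l : N →ₗ[R] (Q ⟶ ((tensor R C).obj M).obj N) :=
    { toFun := k
      map_add' y z := by rw [← cancel_epi q, Preadditive.comp_add, hk, hk, hk, map_add]
      map_smul' r y := by rw [← cancel_epi q, RingHom.id_apply, Linear.comp_smul, hk, hk, map_smul] }
  refine ⟨tensorLift l, tensor_ext fun y => ?_, tensor_ext fun y => ?_⟩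
  · rw [← Category.assoc, tensorMk_map_app, Category.assoc, tensorMk_lift, Category.comp_id]
    exact hk y
  · rw [← Category.assoc, tensorMk_lift, Category.comp_id, ← cancel_epi q, ← Category.assoc]
    exact (congrArg (· ≫ _) (hk y)).trans (tensorMk_map_app q N y)

theorem TensorKills.of_reduction {I : Ideal R} {M' Q M : C} (q : M' ⟶ Q) [Epi q]
    (hq : ∀ ⦃X : C⦄ (_ : killedBy C I X) (g : M' ⟶ X), ∃ g' : Q ⟶ X, q ≫ g' = g) (f : Q ⟶ M)
    {K L : FGModuleCat.{u} R} (hK : ∀ r ∈ I, ∀ y : K, r • y = 0)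
    (hL : ∀ r ∈ I, ∀ y : L, r • y = 0) {ι : K ⟶ L} (h : TensorKills R (q ≫ f) ι) :
    TensorKills R f ι := by
  have := isIso_tensor_map_app_of_reduction q hq hK
  have := isIso_tensor_map_app_of_reduction q hq hL
  intro A x hx
  have := h (x ≫ inv (((tensor R C).map q).app K)) (by
    rw [← cancel_mono (((tensor R C).map q).app L), zero_comp, Category.assoc, Category.assoc,
      NatTrans.naturality, IsIso.inv_hom_id_assoc, hx])
  rwa [Functor.map_comp, NatTrans.comp_app, Category.assoc, IsIso.inv_hom_id_assoc] at this

/-- If the universal map `K → Hom(M, M ⊗ K)` factors through a surjection `p`, then `M ⊗ p` is a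
monomorphism. -/
theorem mono_tensor_map_of_ker_le (M : C) {K K' : FGModuleCat.{u} R} (p : K ⟶ K')
    (hp : Function.Surjective p.hom.hom)
    (h : LinearMap.ker p.hom.hom ≤ LinearMap.ker (tensorMk R M K)) :
    Mono (((tensor R C).obj M).map p) := by
  let e := p.hom.hom.quotKerEquivOfSurjective hp
  let s : ((tensor R C).obj M).obj K' ⟶ ((tensor R C).obj M).obj K :=
    tensorLift (((LinearMap.ker p.hom.hom).liftQ _ h).comp e.symm.toLinearMap)
  have hs : ((tensor R C).obj M).map p ≫ s = 𝟙 _ := tensor_ext fun y => by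
    have h' : e.symm (p.hom.hom y) = (LinearMap.ker p.hom.hom).mkQ y := by
      rw [LinearEquiv.symm_apply_eq]; rfl
    rw [← Category.assoc, tensorMk_map, tensorMk_lift, Category.comp_id]
    change (LinearMap.ker p.hom.hom).liftQ _ h (e.symm (p.hom.hom y)) = _
    rw [h']
    rfl
  have : Mono (((tensor R C).obj M).map p ≫ s) := by rw [hs]; infer_instance
  exact mono_of_mono _ s

/-- The vanishing is checked in the target `M ⊗ K`, so only `M ⊗ p` has to be mono; nothing is
needed of `M' ⊗ p`. -/
theorem TensorKills.of_quotient {M' M : C} (f : M' ⟶ M) {K L K' L' : FGModuleCat.{u} R}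
    {ι : K ⟶ L} {ι' : K' ⟶ L'} (p : K ⟶ K') (p' : L ⟶ L') (hp : p ≫ ι' = ι ≫ p')
    [Mono (((tensor R C).obj M).map p)] (h : TensorKills R f ι') : TensorKills R f ι := by
  intro A x hx
  have := h (x ≫ ((tensor R C).obj M').map p) (by
    rw [Category.assoc, ← Functor.map_comp, hp, Functor.map_comp, ← Category.assoc, hx, zero_comp])
  rwa [← cancel_mono (((tensor R C).obj M).map p), zero_comp, Category.assoc,
    ← NatTrans.naturality, ← Category.assoc]

theorem smul_top_le_ker_tensorMk {I : Ideal R} {M : C} (hM : killedBy C I M)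
    (K : FGModuleCat.{u} R) : I • (⊤ : Submodule R K) ≤ LinearMap.ker (tensorMk R M K) :=
  Submodule.smul_le.2 fun r hr y _ => by
    rw [LinearMap.mem_ker, map_smul, killedBy_smul hM hr]

/-- A consequence of the Artin-Rees lemma. -/
theorem exists_comap_pow_smul_top_le (J : Ideal R) {K L : Type*} [AddCommGroup K] [Module R K]
    [AddCommGroup L] [Module R L] [Module.Finite R L] (ι : K →ₗ[R] L)
    (hι : Function.Injective ι) (n : ℕ) :
    ∃ m, n ≤ m ∧ (J ^ m • (⊤ : Submodule R L)).comap ι ≤ J ^ n • ⊤ := by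
  obtain ⟨k, hk⟩ := Ideal.exists_pow_inf_eq_pow_smul J (LinearMap.range ι)
  -- With `k` the Artin-Rees constant of `K ⊂ L`, `J^(n+k) L ∩ K = J^n (J^k L ∩ K) ⊂ J^n K`.
  refine ⟨n + k, Nat.le_add_right n k, fun y hy => ?_⟩
  have h : ι y ∈ J ^ (n + k) • (⊤ : Submodule R L) ⊓ LinearMap.range ι :=
    ⟨hy, LinearMap.mem_range_self ι y⟩
  rw [hk _ (Nat.le_add_left k n), Nat.add_sub_cancel] at h
  have h' : ι y ∈ J ^ n • LinearMap.range ι := Submodule.smul_mono le_rfl inf_le_right h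
  rw [LinearMap.range_eq_map, ← Submodule.map_smul''] at h'
  obtain ⟨z, hz, hzy⟩ := h'
  exact hι hzy ▸ hz

end Reduction

/-! ### Formal flatness and flatness of the torsion category -/

theorem isScalarTower_quotCat {R : Type u} [CommRing R] {C : Type u'} [Category.{v} C] [Abelian C]
    [Linear R C] (I : Ideal R) (X Y : QuotCat C I) : IsScalarTower R (R ⧸ I) (X ⟶ Y) :=
  IsScalarTower.of_algebraMap_smul fun _ _ => rfl

end LinearAbelian

end

open LinearAbelian in
theorem proposition2p4p2 {R : Type u} [CommRing R] [IsNoetherianRing R] (J : Ideal R)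
    (C : Type u') [Category.{v} C] [Abelian C] [Noetherian.{v, u', w} C] [Linear R C] :
    LinearAbelian.IsFormallyFlat J C ↔ LinearAbelian.IsFlat R (LinearAbelian.TorsionCat C J) := by
  -- For `S = R` the kernel of `R → S` is zero, so the annihilation condition on `L` is vacuous.
  have hflat : IsFlat R (TorsionCat C J) ↔ _ :=
    isFlat_fullSubcategory_iff (R := R) (S := R) (P := killedByPower C J) Function.surjective_id
  have hquot (n : ℕ) : IsFlat (R ⧸ J ^ n) (QuotCat C (J ^ n)) ↔ _ :=
    have := isScalarTower_quotCat (C := C) (J ^ n)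
    isFlat_fullSubcategory_iff (R := R) (P := killedBy C (J ^ n)) Ideal.Quotient.mk_surjective
  rw [hflat]
  refine ⟨fun h M hM K L ι _ _ => ?_, fun h n => (hquot n).2 fun M hM K L ι _ hL => ?_⟩
  · obtain ⟨n, hn⟩ := hM
    obtain ⟨m, hnm, hm⟩ := exists_comap_pow_smul_top_le J ι.hom.hom (fg_injective_of_mono ι) n
    let U : Submodule R L := J ^ m • ⊤
    let ι' : FGModuleCat.of R (K ⧸ U.comap ι.hom.hom) ⟶ FGModuleCat.of R (L ⧸ U) :=
      FGModuleCat.ofHom (Submodule.mapQ _ U ι.hom.hom le_rfl)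
    have : Mono ι' := fg_mono_of_injective _ (by
      refine (injective_iff_map_eq_zero ι'.hom.hom).2 fun y hy => ?_
      obtain ⟨y, rfl⟩ := Submodule.Quotient.mk_surjective _ y
      exact (Submodule.Quotient.mk_eq_zero _).2 ((Submodule.Quotient.mk_eq_zero U).1 hy))
    obtain ⟨M', hM', f, hf, H⟩ := (hquot m).1 (h m) M
      (killedBy_mono (Ideal.pow_le_pow_right hnm) _ hn) ι' (fun r hr y => by
        obtain ⟨y, rfl⟩ := Submodule.Quotient.mk_surjective U y
        rw [← Submodule.Quotient.mk_smul]
        exact (Submodule.Quotient.mk_eq_zero U).2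
          (Submodule.smul_mem_smul (Ideal.Quotient.eq_zero_iff_mem.1 hr) trivial))
    refine ⟨M', ⟨m, hM'⟩, f, hf, ?_⟩
    let p : K ⟶ FGModuleCat.of R (K ⧸ U.comap ι.hom.hom) := FGModuleCat.ofHom (Submodule.mkQ _)
    -- The kernel of `p` is `K ∩ J^m L ⊂ J^n K`, and `J^n` kills `M`. The object `M'` is only known
    -- to be killed by `J^m`.
    have : Mono (((tensor R C).obj M).map p) := mono_tensor_map_of_ker_le M p
      (Submodule.mkQ_surjective _) ((Submodule.ker_mkQ _).le.trans
        (hm.trans (smul_top_le_ker_tensorMk hn K)))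
    exact TensorKills.of_quotient f p (FGModuleCat.ofHom (Submodule.mkQ _)) rfl H
  · have hL' : ∀ r ∈ J ^ n, ∀ y : L, r • y = 0 := fun r hr =>
      hL r (Ideal.Quotient.eq_zero_iff_mem.2 hr)
    obtain ⟨M', -, f, hf, H⟩ := h M ⟨n, hM⟩ ι fun r hr y => by
      rw [show r = 0 from hr, zero_smul]
    -- `M'` may be killed only by a higher power of `J`; since `J^n` kills `M`, `f` factors through
    -- `M'/J^n M'`.
    obtain ⟨Q, q, hQ, hq, hlift⟩ := exists_reduction (J ^ n) M'
    obtain ⟨f', rfl⟩ := hlift hM f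
    refine ⟨Q, hQ, f', epi_of_epi q f', TensorKills.of_reduction q hlift f' ?_ hL' H⟩
    exact fun r hr y => fg_injective_of_mono ι (by rw [map_smul, hL' r hr, map_zero])
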